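/- There is a universal constant $C>0$ with the following property. Let $n\ge 2$, let $X$ be an $n\times n$ real symmetric random matrix whose entries $X_{ij}$, $i\le j$, are independent with $\mathbf{E}X_{ij}=0$, and let $K>0$ and $b_{ij}\ge 0$ $(1\le i,j\le n)$ be real numbers such that $\|X_{ij}\|_\infty\le K\,b_{ij}$ for all $i,j$, that is, $|X_{ij}|\le K\,b_{ij}$ almost surely. Then the spectral norm $\|X\|$ (the largest singular value of $X$) is integrable and $$ \mathbf{E}\|X\|\;\le\; C\,K\,\max_{1\le i\le n}\Bigg(\sum_{j=1}^n b_{ij}^2\Bigg)^{1/2}(\log n)^{1/4}. $$ -/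

import Mathlib

open MeasureTheory ProbabilityTheory

/-- The spectral norm (largest singular value) of a real square matrix, as the operator norm of the
matrix acting on Euclidean space. -/
noncomputable def matrixSpectralNorm {n : ℕ} (A : Matrix (Fin n) (Fin n) ℝ) : ℝ :=
  ‖Matrix.toEuclideanCLM (n := Fin n) (𝕜 := ℝ) A‖

/-- A random symmetric real matrix whose entries are random variables that are independent modulo
symmetry: the entries on and above the diagonal are mutually independent. -/
structure IsIndepSymmRandomMatrix {n : ℕ} {Ω : Type*} [MeasurableSpace Ω]
    (X : Ω → Matrix (Fin n) (Fin n) ℝ) (μ : Measure Ω) : Prop where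
  measurable : ∀ i j, Measurable fun ω => X ω i j
  symm : ∀ ω, (X ω).IsSymm
  indep : iIndepFun (fun (p : {p : Fin n × Fin n // p.1 ≤ p.2}) (ω : Ω) => X ω p.1.1 p.1.2) μ

/-! ### Averages over signs -/

/-- The real sign attached to a Boolean. -/
def boolSign (b : Bool) : ℝ := if b then 1 else -1

lemma sum_prod_bool {ι : Type*} [Fintype ι] [DecidableEq ι] (f : ι → Bool → ℝ) :
    ∑ s : ι → Bool, ∏ i, f i (s i) = ∏ i, (f i true + f i false) := by
  have h := Finset.prod_univ_sum (fun _ : ι => (Finset.univ : Finset Bool)) f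
  simp only [Fintype.piFinset_univ, Fintype.sum_bool] at h
  exact h.symm

lemma sum_prod_boolSign {ι : Type*} [Fintype ι] [DecidableEq ι] {k : ℕ} (e : Fin k → ι) :
    ∑ s : ι → Bool, ∏ t, boolSign (s (e t)) =
      if ∀ i, Even (Finset.univ.filter fun t => e t = i).card
        then (2 : ℝ) ^ Fintype.card ι else 0 := by
  have h1 : ∀ s : ι → Bool, ∏ t, boolSign (s (e t)) =
      ∏ i, boolSign (s i) ^ (Finset.univ.filter fun t => e t = i).card := by
    intro s
    rw [← Finset.prod_fiberwise Finset.univ e]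
    refine Finset.prod_congr rfl fun i _ => ?_
    rw [Finset.prod_congr rfl (g := fun _ => boolSign (s i)), Finset.prod_const]
    intro t ht
    rw [(Finset.mem_filter.1 ht).2]
  simp_rw [h1]
  rw [sum_prod_bool (fun i b => boolSign b ^ (Finset.univ.filter fun t => e t = i).card)]
  split_ifs with h
  · rw [Finset.prod_congr rfl (g := fun _ => (2 : ℝ))]
    · simp
    · intro i _
      simp only [boolSign, if_true, one_pow, Bool.false_eq_true, if_false, (h i).neg_one_pow]
      norm_num
  · push Not at h
    obtain ⟨i, hi⟩ := h
    refine Finset.prod_eq_zero (Finset.mem_univ i) ?_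
    simp [boolSign, (Nat.not_even_iff_odd.1 hi).neg_one_pow]

/-- Moments of a Rademacher sum. -/
lemma sum_rademacher_pow_le {ι : Type*} [Fintype ι] [DecidableEq ι] (c : ι → ℝ)
    (hc : ∑ i, c i ^ 2 ≤ 2) {p : ℕ} (hp : 0 < p) :
    ∑ s : ι → Bool, (∑ i, c i * boolSign (s i)) ^ (2 * p) ≤
      2 ^ Fintype.card ι * (2 * (16 * p) ^ p) := by
  have hp' : (0 : ℝ) < p := by exact_mod_cast hp
  set t : ℝ := √(2 * p) with ht
  have ht2 : t ^ 2 = 2 * p := Real.sq_sqrt (by positivity)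
  have ht0 : 0 ≤ t := Real.sqrt_nonneg _
  have hmgf : ∀ a : ℝ, a ^ 2 = 2 * p → ∑ s : ι → Bool, Real.exp (a * ∑ i, c i * boolSign (s i)) ≤
      2 ^ Fintype.card ι * Real.exp (2 * p) := by
    intro a ha
    have h1 : ∀ s : ι → Bool, Real.exp (a * ∑ i, c i * boolSign (s i)) =
        ∏ i, Real.exp (a * (c i * boolSign (s i))) := by
      intro s
      rw [Finset.mul_sum, Real.exp_sum]
    simp_rw [h1]
    rw [sum_prod_bool (fun i b => Real.exp (a * (c i * boolSign b)))]
    calc ∏ i, (Real.exp (a * (c i * boolSign true)) + Real.exp (a * (c i * boolSign false)))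
        ≤ ∏ i, (2 * Real.exp ((a * c i) ^ 2 / 2)) := by
          refine Finset.prod_le_prod (fun i _ => by positivity) fun i _ => ?_
          have := Real.cosh_le_exp_half_sq (a * c i)
          rw [Real.cosh_eq] at this
          simp only [boolSign, if_true, Bool.false_eq_true, if_false, mul_one, mul_neg]
          linarith
      _ = 2 ^ Fintype.card ι * Real.exp (∑ i, (a * c i) ^ 2 / 2) := by
          rw [Finset.prod_mul_distrib, Finset.prod_const, Real.exp_sum, Finset.card_univ]
      _ ≤ _ := by
          gcongr
          have : ∑ i, (a * c i) ^ 2 / 2 = p * ∑ i, c i ^ 2 := by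
            rw [Finset.mul_sum]
            refine Finset.sum_congr rfl fun i _ => ?_
            rw [mul_pow, ha]; ring
          rw [this]
          nlinarith
  have hpt : ∀ x : ℝ, (2 * p) ^ p * x ^ (2 * p) ≤
      (2 * p) ^ (2 * p) * (Real.exp (t * x) + Real.exp (-t * x)) := by
    intro x
    have h2 : |t * x| ^ (2 * p) / (2 * p).factorial ≤ Real.exp |t * x| :=
      Real.pow_div_factorial_le_exp _ (abs_nonneg _) _
    have h3 : Real.exp |t * x| ≤ Real.exp (t * x) + Real.exp (-t * x) := by
      rcases abs_choice (t * x) with h | h <;> rw [h]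
      · linarith [Real.exp_pos (-t * x)]
      · rw [neg_mul]; linarith [Real.exp_pos (t * x)]
    have h4 : |t * x| ^ (2 * p) = (2 * p) ^ p * x ^ (2 * p) := by
      rw [pow_mul, sq_abs, mul_pow, ht2, mul_pow, ← pow_mul]
    have h5 : ((2 * p).factorial : ℝ) ≤ (2 * p) ^ (2 * p) := by
      exact_mod_cast Nat.factorial_le_pow (2 * p)
    rw [h4, div_le_iff₀ (by positivity)] at h2
    refine h2.trans ?_
    rw [mul_comm]
    gcongr
  have hsum : (2 * p : ℝ) ^ p * ∑ s : ι → Bool, (∑ i, c i * boolSign (s i)) ^ (2 * p) ≤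
      (2 * p) ^ (2 * p) * (2 * (2 ^ Fintype.card ι * Real.exp (2 * p))) := by
    rw [Finset.mul_sum]
    calc _ ≤ ∑ s : ι → Bool, (2 * p : ℝ) ^ (2 * p) *
          (Real.exp (t * ∑ i, c i * boolSign (s i)) + Real.exp (-t * ∑ i, c i * boolSign (s i))) :=
          Finset.sum_le_sum fun s _ => hpt _
      _ ≤ _ := by
          rw [← Finset.mul_sum, Finset.sum_add_distrib]
          gcongr
          linarith [hmgf t ht2, hmgf (-t) (by rw [neg_sq, ht2])]
  have hexp : Real.exp (2 * p) ≤ 8 ^ p := by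
    have h6 : Real.exp 2 ≤ 8 := by
      have := Real.exp_one_lt_d9
      have h7 : Real.exp 2 = Real.exp 1 * Real.exp 1 := by rw [← Real.exp_add]; norm_num
      rw [h7]
      nlinarith [Real.exp_pos 1]
    calc Real.exp (2 * p) = Real.exp 2 ^ p := by rw [← Real.exp_nat_mul]; ring_nf
      _ ≤ 8 ^ p := by gcongr
  have hpp : (0 : ℝ) < (2 * p) ^ p := by positivity
  refine le_of_mul_le_mul_left (hsum.trans ?_) hpp
  calc (2 * p : ℝ) ^ (2 * p) * (2 * (2 ^ Fintype.card ι * Real.exp (2 * p)))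
      ≤ (2 * p : ℝ) ^ (2 * p) * (2 * (2 ^ Fintype.card ι * 8 ^ p)) := by gcongr
    _ = _ := by
      have : (16 * p : ℝ) ^ p = (2 * p) ^ p * 8 ^ p := by rw [← mul_pow]; ring_nf
      rw [this, two_mul p, pow_add]; ring

/-! ### Discretization of the operator norm -/

lemma exists_half_net (r : ℕ) : ∃ N : Finset (EuclideanSpace ℝ (Fin r)), N.card ≤ 5 ^ r ∧
    (∀ x ∈ N, ‖x‖ ≤ 1) ∧ ∀ x, ‖x‖ ≤ 1 → ∃ y ∈ N, ‖x - y‖ ≤ 1 / 2 := by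
  classical
  let P : Finset (EuclideanSpace ℝ (Fin r)) → Prop := fun N =>
    (∀ x ∈ N, ‖x‖ ≤ 1) ∧ ∀ x ∈ N, ∀ y ∈ N, x ≠ y → 1 / 2 ≤ ‖x - y‖
  have hcard : ∀ N, P N → N.card ≤ 5 ^ r := by
    intro N hN
    have hinj : Function.Injective fun x : EuclideanSpace ℝ (Fin r) => (2 : ℝ) • x :=
      smul_right_injective _ two_ne_zero
    have := Besicovitch.card_le_of_separated (N.image fun x => (2 : ℝ) • x) (by
      intro c hc
      obtain ⟨x, hx, rfl⟩ := Finset.mem_image.1 hc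
      rw [norm_smul]
      have := hN.1 x hx
      norm_num
      linarith) (by
      intro c hc d hd hcd
      obtain ⟨x, hx, rfl⟩ := Finset.mem_image.1 hc
      obtain ⟨y, hy, rfl⟩ := Finset.mem_image.1 hd
      have := hN.2 x hx y hy (fun h => hcd (by rw [h]))
      simp only [← smul_sub, norm_smul]
      norm_num
      linarith)
    rwa [Finset.card_image_of_injective _ hinj, finrank_euclideanSpace_fin] at this
  obtain ⟨m, ⟨N, hN, rfl⟩, hmax⟩ : ∃ m, (∃ N, P N ∧ N.card = m) ∧
      ∀ N, P N → N.card ≤ m := by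
    have hex : ∃ k, ∃ N, P N ∧ N.card = k := ⟨0, ∅, ⟨by simp, by simp⟩, rfl⟩
    have hb : ∀ k, (∃ N, P N ∧ N.card = k) → k ≤ 5 ^ r := by
      rintro k ⟨N, hN, rfl⟩; exact hcard N hN
    obtain ⟨k, hk⟩ := hex
    refine ⟨Nat.findGreatest (fun k => ∃ N, P N ∧ N.card = k) (5 ^ r),
      Nat.findGreatest_spec (P := fun k => ∃ N, P N ∧ N.card = k) (hb k hk) hk, fun N hN => ?_⟩
    exact Nat.le_findGreatest (P := fun k => ∃ N, P N ∧ N.card = k) (hcard N hN) ⟨N, hN, rfl⟩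
  refine ⟨N, hcard N hN, hN.1, fun x hx => ?_⟩
  by_contra! hcon
  have hxN : x ∉ N := fun h => by have := hcon x h; norm_num at this
  have := hmax (insert x N) ⟨?_, ?_⟩
  · rw [Finset.card_insert_of_notMem hxN] at this
    omega
  · intro y hy
    rcases Finset.mem_insert.1 hy with rfl | hy
    exacts [hx, hN.1 y hy]
  · intro y hy z hz hyz
    rcases Finset.mem_insert.1 hy with rfl | hy' <;> rcases Finset.mem_insert.1 hz with rfl | hz'
    · exact absurd rfl hyz
    · exact (hcon z hz').le
    · rw [norm_sub_rev]; exact (hcon y hy').le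
    · exact hN.2 y hy' z hz' hyz

lemma opNorm_le_two_mul_of_net {E F : Type*} [NormedAddCommGroup E] [NormedSpace ℝ E]
    [NormedAddCommGroup F] [NormedSpace ℝ F] {N : Finset E}
    (hN : ∀ x, ‖x‖ ≤ 1 → ∃ y ∈ N, ‖x - y‖ ≤ 1 / 2) (T : E →L[ℝ] F) {b : ℝ}
    (hb : ∀ y ∈ N, ‖T y‖ ≤ b) : ‖T‖ ≤ 2 * b := by
  have hb0 : 0 ≤ b := by
    obtain ⟨y, hy, -⟩ := hN 0 (by simp)
    exact (norm_nonneg _).trans (hb y hy)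
  have : ‖T‖ ≤ b + ‖T‖ / 2 := by
    refine T.opNorm_le_of_unit_norm (by positivity) fun x hx => ?_
    obtain ⟨y, hy, hxy⟩ := hN x hx.le
    have h1 : T x = T y + T (x - y) := by simp
    rw [h1]
    refine (norm_add_le _ _).trans (add_le_add (hb y hy) ?_)
    refine (T.le_opNorm _).trans ?_
    nlinarith [norm_nonneg T]
  linarith

lemma opNorm_le_four_mul_of_net {E : Type*} [NormedAddCommGroup E] [InnerProductSpace ℝ E]
    {N : Finset E} (hN : ∀ x, ‖x‖ ≤ 1 → ∃ y ∈ N, ‖x - y‖ ≤ 1 / 2)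
    (T : E →L[ℝ] E) {a : ℝ} (ha : ∀ x ∈ N, ∀ y ∈ N, |inner ℝ x (T y)| ≤ a) :
    ‖T‖ ≤ 4 * a := by
  have h : ∀ y ∈ N, ‖T y‖ ≤ 2 * a := by
    intro y hy
    have := opNorm_le_two_mul_of_net hN (innerSL ℝ (T y)) (b := a) (fun x hx => by
      rw [innerSL_apply_apply, real_inner_comm]
      exact ha x hx y hy)
    rwa [innerSL_apply_norm] at this
  have := opNorm_le_two_mul_of_net hN T h
  linarith

/-- The even powers of the operator norm are dominated by sums over a net. -/
lemma opNorm_pow_le_sum_net {E : Type*} [NormedAddCommGroup E] [InnerProductSpace ℝ E]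
    {N : Finset E} (hN : ∀ x, ‖x‖ ≤ 1 → ∃ y ∈ N, ‖x - y‖ ≤ 1 / 2)
    (T : E →L[ℝ] E) (p : ℕ) :
    ‖T‖ ^ (2 * p) ≤ 16 ^ p * ∑ z ∈ N ×ˢ N, (inner ℝ z.1 (T z.2)) ^ (2 * p) := by
  have hne : (N ×ˢ N).Nonempty := by
    obtain ⟨y, hy, -⟩ := hN 0 (by simp)
    exact ⟨(y, y), by simp [hy]⟩
  obtain ⟨z, hz, hmax⟩ := Finset.exists_max_image (N ×ˢ N) (fun z => |inner ℝ z.1 (T z.2)|) hne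
  have h1 : ‖T‖ ≤ 4 * |inner ℝ z.1 (T z.2)| :=
    opNorm_le_four_mul_of_net hN T fun x hx y hy => hmax (x, y) (by simp [hx, hy])
  calc ‖T‖ ^ (2 * p) ≤ (4 * |inner ℝ z.1 (T z.2)|) ^ (2 * p) := by gcongr
    _ = 16 ^ p * (inner ℝ z.1 (T z.2)) ^ (2 * p) := by
      rw [mul_pow, (even_two_mul p).pow_abs, pow_mul 4]
      norm_num
    _ ≤ _ := by
      gcongr
      exact Finset.single_le_sum (f := fun z : E × E => (inner ℝ z.1 (T z.2)) ^ (2 * p))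
        (fun z _ => Even.pow_nonneg (even_two_mul p) _) hz

/-! ### Sign matrices -/

/-- The symmetric matrix with entries `± A i j`, with signs given by `s`. -/
def signMatrix {V : Type*} (A : Matrix V V ℝ) (s : Sym2 V → Bool) : Matrix V V ℝ :=
  fun i j => A i j * boolSign (s s(i, j))

lemma signMatrix_isSymm {V : Type*} {A : Matrix V V ℝ} (hA : A.IsSymm) (s : Sym2 V → Bool) :
    (signMatrix A s).IsSymm := by
  ext i j
  rw [Matrix.transpose_apply, signMatrix, signMatrix, hA.apply, Sym2.eq_swap]

lemma sum_sq_fiber_le {V : Type*} [Fintype V] [DecidableEq V] (x y : V → ℝ)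
    (hx : ∑ i, x i ^ 2 ≤ 1) (hy : ∑ i, y i ^ 2 ≤ 1) :
    ∑ e : Sym2 V, (∑ z ∈ Finset.univ.filter (fun z : V × V => s(z.1, z.2) = e),
      x z.1 * y z.2) ^ 2 ≤ 2 := by
  have hcard : ∀ e : Sym2 V,
      (Finset.univ.filter (fun z : V × V => s(z.1, z.2) = e)).card ≤ 2 := by
    intro e
    induction e using Sym2.ind with
    | _ a b =>
      refine (Finset.card_le_card (t := {(a, b), (b, a)}) ?_).trans Finset.card_le_two
      rintro ⟨c, d⟩ h
      simpa [Sym2.eq_iff] using h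
  calc _ ≤ ∑ e : Sym2 V, 2 * ∑ z ∈ Finset.univ.filter (fun z : V × V => s(z.1, z.2) = e),
      (x z.1 * y z.2) ^ 2 := by
        refine Finset.sum_le_sum fun e _ => ?_
        refine sq_sum_le_card_mul_sum_sq.trans ?_
        gcongr
        exact_mod_cast hcard e
    _ = 2 * ((∑ i, x i ^ 2) * ∑ i, y i ^ 2) := by
        rw [← Finset.mul_sum, Finset.sum_fiberwise, Finset.sum_mul_sum, ← Finset.univ_product_univ,
          Finset.sum_product]
        simp_rw [mul_pow]
    _ ≤ 2 := by
        have h1 : 0 ≤ ∑ i, x i ^ 2 := Finset.sum_nonneg fun i _ => sq_nonneg _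
        have h2 : 0 ≤ ∑ i, y i ^ 2 := Finset.sum_nonneg fun i _ => sq_nonneg _
        nlinarith

/-- Moments of the norm of a symmetric Rademacher matrix. -/
lemma sum_norm_rademacher_pow_le (r : ℕ) {p : ℕ} (hp : 0 < p) :
    ∑ s : Sym2 (Fin r) → Bool,
      matrixSpectralNorm (signMatrix (fun _ _ => 1) s) ^ (2 * p) ≤
      2 ^ Fintype.card (Sym2 (Fin r)) * (16 ^ p * (25 ^ r * (2 * (16 * p) ^ p))) := by
  obtain ⟨N, hcard, hN1, hN⟩ := exists_half_net r
  have key : ∀ z ∈ N ×ˢ N, ∑ s : Sym2 (Fin r) → Bool, (inner ℝ z.1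
      (Matrix.toEuclideanCLM (n := Fin r) (𝕜 := ℝ) (signMatrix (fun _ _ => 1) s) z.2)) ^ (2 * p) ≤
      2 ^ Fintype.card (Sym2 (Fin r)) * (2 * (16 * p) ^ p) := by
    rintro ⟨x, y⟩ hz
    obtain ⟨hx, hy⟩ := Finset.mem_product.1 hz
    have hsq : ∀ w ∈ N, ∑ i, w i ^ 2 ≤ 1 := by
      intro w hw
      rw [← EuclideanSpace.real_norm_sq_eq]
      have := hN1 w hw
      nlinarith [norm_nonneg w]
    refine le_trans (le_of_eq (Finset.sum_congr rfl fun s _ => ?_))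
      (sum_rademacher_pow_le _ (sum_sq_fiber_le (fun i => x i) (fun i => y i)
        (hsq x hx) (hsq y hy)) hp)
    congr 1
    rw [Matrix.inner_toEuclideanCLM]
    simp only [dotProduct, Matrix.mulVec, signMatrix, Finset.sum_mul, Finset.mul_sum]
    have : ∀ e : Sym2 (Fin r), ∑ z ∈ Finset.univ.filter (fun z : Fin r × Fin r => s(z.1, z.2) = e),
        x z.1 * y z.2 * boolSign (s e) =
        ∑ z ∈ Finset.univ.filter (fun z : Fin r × Fin r => s(z.1, z.2) = e),
        x z.1 * y z.2 * boolSign (s s(z.1, z.2)) := by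
      intro e
      refine Finset.sum_congr rfl fun z hz => ?_
      rw [(Finset.mem_filter.1 hz).2]
    simp_rw [this]
    rw [Finset.sum_fiberwise, ← Finset.univ_product_univ, Finset.sum_product]
    refine Finset.sum_congr rfl fun i _ => Finset.sum_congr rfl fun j _ => ?_
    simp
    ring
  calc _ ≤ ∑ s : Sym2 (Fin r) → Bool, 16 ^ p * ∑ z ∈ N ×ˢ N, (inner ℝ z.1
      (Matrix.toEuclideanCLM (n := Fin r) (𝕜 := ℝ) (signMatrix (fun _ _ => 1) s) z.2)) ^ (2 * p) :=
        Finset.sum_le_sum fun s _ => opNorm_pow_le_sum_net hN _ p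
    _ ≤ 16 ^ p * ∑ z ∈ N ×ˢ N, 2 ^ Fintype.card (Sym2 (Fin r)) * (2 * (16 * p : ℝ) ^ p) := by
        rw [← Finset.mul_sum, Finset.sum_comm]
        gcongr with z hz
        exact key z hz
    _ ≤ 16 ^ p * (25 ^ r * (2 ^ Fintype.card (Sym2 (Fin r)) * (2 * (16 * p : ℝ) ^ p))) := by
        rw [Finset.sum_const, nsmul_eq_mul, Finset.card_product]
        gcongr
        have : (N.card : ℝ) ≤ 5 ^ r := by exact_mod_cast hcard
        push_cast
        calc (N.card : ℝ) * N.card ≤ 5 ^ r * 5 ^ r := by gcongr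
          _ = 25 ^ r := by rw [← mul_pow]; norm_num
    _ = _ := by ring

/-! ### Norms, traces and closed walks -/

lemma matrixSpectralNorm_nonneg {n : ℕ} (A : Matrix (Fin n) (Fin n) ℝ) :
    0 ≤ matrixSpectralNorm A := norm_nonneg _

lemma matrixSpectralNorm_le_of_forall {n : ℕ} (A : Matrix (Fin n) (Fin n) ℝ) {R : ℝ} (hR : 0 ≤ R)
    (h : ∀ x : Fin n → ℝ, ∑ i, (∑ j, A i j * x j) ^ 2 ≤ R ^ 2 * ∑ i, x i ^ 2) :
    matrixSpectralNorm A ≤ R := by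
  refine ContinuousLinearMap.opNorm_le_bound _ hR fun x => ?_
  refine abs_le_of_sq_le_sq' ?_ (by positivity) |>.2
  rw [mul_pow, EuclideanSpace.real_norm_sq_eq, EuclideanSpace.real_norm_sq_eq]
  simpa only [Matrix.ofLp_toEuclideanCLM, Matrix.mulVec, dotProduct] using h x

lemma matrixSpectralNorm_sq_le_frobenius {n : ℕ} (A : Matrix (Fin n) (Fin n) ℝ) :
    matrixSpectralNorm A ^ 2 ≤ ∑ i, ∑ j, A i j ^ 2 := by
  have h0 : 0 ≤ ∑ i, ∑ j, A i j ^ 2 :=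
    Finset.sum_nonneg fun i _ => Finset.sum_nonneg fun j _ => sq_nonneg _
  have := matrixSpectralNorm_le_of_forall A (Real.sqrt_nonneg (∑ i, ∑ j, A i j ^ 2)) (fun x => by
    rw [Real.sq_sqrt h0, Finset.sum_mul]
    exact Finset.sum_le_sum fun i _ => Finset.sum_mul_sq_le_sq_mul_sq _ _ _)
  calc _ ≤ √(∑ i, ∑ j, A i j ^ 2) ^ 2 := by
        have := matrixSpectralNorm_nonneg A
        gcongr
    _ = _ := Real.sq_sqrt h0

/-- The row-sum bound for the norm of a matrix whose absolute values form a symmetric matrix. -/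
lemma matrixSpectralNorm_le_of_row_sum {n : ℕ} (A : Matrix (Fin n) (Fin n) ℝ) {R : ℝ} (hR : 0 ≤ R)
    (hs : ∀ i j, |A i j| = |A j i|) (h : ∀ i, ∑ j, |A i j| ≤ R) :
    matrixSpectralNorm A ≤ R := by
  refine matrixSpectralNorm_le_of_forall A hR fun x => ?_
  calc ∑ i, (∑ j, A i j * x j) ^ 2 ≤ ∑ i, R * ∑ j, |A i j| * x j ^ 2 := by
        refine Finset.sum_le_sum fun i _ => ?_
        have h1 : (∑ j, A i j * x j) ^ 2 ≤ (∑ j, |A i j|) * ∑ j, |A i j| * x j ^ 2 := by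
          refine Finset.sum_sq_le_sum_mul_sum_of_sq_le_mul _ (fun j _ => abs_nonneg _)
            (fun j _ => by positivity) fun j _ => ?_
          rw [mul_pow, ← sq_abs (A i j), sq |A i j|, mul_assoc]
        refine h1.trans ?_
        have : 0 ≤ ∑ j, |A i j| * x j ^ 2 := Finset.sum_nonneg fun j _ => by positivity
        gcongr
        exact h i
    _ = R * ∑ j, (∑ i, |A j i|) * x j ^ 2 := by
        rw [← Finset.mul_sum, Finset.sum_comm]
        congr 1
        refine Finset.sum_congr rfl fun j _ => ?_
        rw [Finset.sum_mul]
        exact Finset.sum_congr rfl fun i _ => by rw [hs]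
    _ ≤ R * ∑ j, R * x j ^ 2 := by
        gcongr with j
        exact h j
    _ = _ := by rw [← Finset.mul_sum]; ring

lemma matrixSpectralNorm_pow_of_isSymm {n : ℕ} {A : Matrix (Fin n) (Fin n) ℝ} (hA : A.IsSymm)
    (k : ℕ) : matrixSpectralNorm (A ^ 2 ^ k) = matrixSpectralNorm A ^ 2 ^ k := by
  have : IsSelfAdjoint (Matrix.toEuclideanCLM (n := Fin n) (𝕜 := ℝ) A) := by
    have h : star A = A := by
      rw [Matrix.star_eq_conjTranspose, Matrix.conjTranspose_eq_transpose_of_trivial, hA.eq]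
    rw [IsSelfAdjoint, ← map_star, h]
  rw [matrixSpectralNorm, map_pow, this.norm_pow_two_pow,
    matrixSpectralNorm]

lemma matrixSpectralNorm_pow_le_trace {n : ℕ} {A : Matrix (Fin n) (Fin n) ℝ} (hA : A.IsSymm)
    (k : ℕ) : matrixSpectralNorm A ^ (2 * 2 ^ k) ≤ (A ^ (2 * 2 ^ k)).trace := by
  have hsymm : (A ^ 2 ^ k).IsSymm := by
    rw [Matrix.IsSymm, Matrix.transpose_pow, hA.eq]
  calc _ = matrixSpectralNorm (A ^ 2 ^ k) ^ 2 := by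
        rw [matrixSpectralNorm_pow_of_isSymm hA, ← pow_mul, mul_comm]
    _ ≤ _ := matrixSpectralNorm_sq_le_frobenius _
    _ = _ := by
        rw [two_mul, pow_add, Matrix.trace]
        refine Finset.sum_congr rfl fun i _ => ?_
        rw [Matrix.diag_apply, Matrix.mul_apply]
        refine Finset.sum_congr rfl fun j _ => ?_
        rw [hsymm.apply i j, sq]

lemma trace_pow_le {n : ℕ} (A : Matrix (Fin n) (Fin n) ℝ) {m : ℕ} (hm : 0 < m) :
    (A ^ m).trace ≤ n * matrixSpectralNorm A ^ m := by
  have h : ∀ i, (A ^ m) i i ≤ matrixSpectralNorm A ^ m := by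
    intro i
    have h1 : (A ^ m) i i = inner ℝ (EuclideanSpace.single i (1 : ℝ))
        (Matrix.toEuclideanCLM (n := Fin n) (𝕜 := ℝ) (A ^ m) (EuclideanSpace.single i (1 : ℝ))) := by
      generalize A ^ m = M
      simp [EuclideanSpace.inner_single_left]
    rw [h1]
    refine (real_inner_le_norm _ _).trans ?_
    have := (Matrix.toEuclideanCLM (n := Fin n) (𝕜 := ℝ) (A ^ m)).le_opNorm
      (EuclideanSpace.single i (1 : ℝ))
    simp only [PiLp.norm_single, norm_one, mul_one, one_mul] at this ⊢
    refine this.trans ?_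
    rw [map_pow]
    exact norm_pow_le' _ hm
  calc (A ^ m).trace ≤ ∑ _i : Fin n, matrixSpectralNorm A ^ m := Finset.sum_le_sum fun i _ => h i
    _ = _ := by simp

/-- The product of matrix entries along a walk. -/
def walkWeight {V : Type*} (A : Matrix V V ℝ) {k : ℕ} (u : Fin (k + 1) → V) : ℝ :=
  ∏ t : Fin k, A (u t.castSucc) (u t.succ)

lemma sum_fin_succ_fun {V : Type*} [Fintype V] {k : ℕ} (f : (Fin (k + 1) → V) → ℝ) :
    ∑ u, f u = ∑ u : Fin k → V, ∑ a, f (Fin.snoc u a) := by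
  rw [← (Fin.snocEquiv fun _ : Fin (k + 1) => V).sum_comp, Fintype.sum_prod_type_right]
  rfl

lemma walkWeight_snoc {V : Type*} (A : Matrix V V ℝ) {k : ℕ} (u : Fin (k + 1) → V) (a : V) :
    walkWeight A (Fin.snoc u a : Fin (k + 2) → V) = walkWeight A u * A (u (Fin.last k)) a := by
  rw [walkWeight, Fin.prod_univ_castSucc]
  congr 1
  · refine Finset.prod_congr rfl fun t _ => ?_
    rw [Fin.snoc_castSucc, Fin.succ_castSucc, Fin.snoc_castSucc]
  · rw [Fin.snoc_castSucc, Fin.succ_last, Fin.snoc_last]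

lemma pow_apply_eq_sum_walk {V : Type*} [Fintype V] [DecidableEq V] (A : Matrix V V ℝ) (k : ℕ)
    (i j : V) : (A ^ k) i j = ∑ u : Fin (k + 1) → V,
      if u 0 = i ∧ u (Fin.last k) = j then walkWeight A u else 0 := by
  induction k generalizing j with
  | zero =>
    rw [sum_fin_succ_fun]
    simp only [pow_zero, Matrix.one_apply, walkWeight, Finset.univ_eq_empty, Finset.prod_empty,
      Finset.univ_unique, Finset.sum_singleton]
    have : ∀ a : V, (Fin.snoc (default : Fin 0 → V) a : Fin 1 → V) 0 = a := fun a => rfl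
    simp only [Fin.last_zero, this]
    by_cases h : i = j
    · subst h; simp
    · rw [if_neg h, Finset.sum_eq_zero]
      intro a _
      rw [if_neg]
      rintro ⟨rfl, h'⟩
      exact h h'
  | succ k ih =>
    rw [pow_succ, Matrix.mul_apply, sum_fin_succ_fun]
    simp_rw [ih, Finset.sum_mul]
    rw [Finset.sum_comm]
    refine Finset.sum_congr rfl fun u _ => ?_
    have h0 : ∀ a : V, (Fin.snoc u a : Fin (k + 2) → V) 0 = u 0 := fun a => by
      rw [← Fin.castSucc_zero, Fin.snoc_castSucc]
    simp only [h0, Fin.snoc_last, walkWeight_snoc]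
    rw [Finset.sum_eq_single (u (Fin.last k)), Finset.sum_eq_single j]
    · by_cases h : u 0 = i <;> simp [h]
    · intro a _ ha
      simp [ha]
    · simp
    · intro a _ ha
      simp [ha.symm]
    · simp

lemma trace_pow_eq_sum_walk {V : Type*} [Fintype V] [DecidableEq V] (A : Matrix V V ℝ) (k : ℕ) :
    (A ^ k).trace = ∑ u : Fin (k + 1) → V, if u 0 = u (Fin.last k) then walkWeight A u else 0 := by
  simp only [Matrix.trace, Matrix.diag_apply, pow_apply_eq_sum_walk]
  rw [Finset.sum_comm]
  refine Finset.sum_congr rfl fun u _ => ?_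
  rw [Finset.sum_eq_single (u 0)]
  · simp [eq_comm]
  · intro b _ hb
    rw [if_neg]
    rintro ⟨h, -⟩
    exact hb h.symm
  · simp

/-- A closed walk that traverses each edge an even number of times. -/
def IsEvenWalk {V : Type*} [DecidableEq V] {k : ℕ} (u : Fin (k + 1) → V) : Prop :=
  u 0 = u (Fin.last k) ∧
    ∀ e : Sym2 V, Even (Finset.univ.filter fun t : Fin k => s(u t.castSucc, u t.succ) = e).card

open Classical in
lemma sum_trace_signMatrix_pow {V : Type*} [Fintype V] [DecidableEq V] (A : Matrix V V ℝ) (k : ℕ) :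
    ∑ s : Sym2 V → Bool, (signMatrix A s ^ k).trace =
      2 ^ Fintype.card (Sym2 V) *
        ∑ u : Fin (k + 1) → V, if IsEvenWalk u then walkWeight A u else 0 := by
  simp_rw [trace_pow_eq_sum_walk]
  rw [Finset.sum_comm, Finset.mul_sum]
  refine Finset.sum_congr rfl fun u _ => ?_
  by_cases h : u 0 = u (Fin.last k)
  · simp only [h, if_true, IsEvenWalk, true_and]
    have : ∀ s : Sym2 V → Bool, walkWeight (signMatrix A s) u =
        walkWeight A u * ∏ t : Fin k, boolSign (s s(u t.castSucc, u t.succ)) := by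
      intro s
      rw [walkWeight, walkWeight, ← Finset.prod_mul_distrib]
      rfl
    simp_rw [this]
    rw [← Finset.mul_sum, sum_prod_boolSign (fun t : Fin k => s(u t.castSucc, u t.succ))]
    by_cases he : ∀ e : Sym2 V,
        Even (Finset.univ.filter fun t : Fin k => s(u t.castSucc, u t.succ) = e).card
    · rw [if_pos he, if_pos he, mul_comm]
    · rw [if_neg he, if_neg he, mul_zero, mul_zero]
  · simp [h, IsEvenWalk]

/-! ### Comparison of even walks -/

/-- Two sequences with the same coincidence pattern. -/
def SameKer {ι V W : Type*} (u : ι → V) (w : ι → W) : Prop := ∀ i j, u i = u j ↔ w i = w j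

/-- The step `t` of a walk leads to a vertex that was not visited before. -/
def IsFreshStep {V : Type*} {k : ℕ} (u : Fin (k + 1) → V) (t : Fin k) : Prop :=
  ∀ j : Fin (k + 1), j ≤ t.castSucc → u j ≠ u t.succ

lemma SameKer.isFreshStep_iff {V W : Type*} {k : ℕ} {u : Fin (k + 1) → V} {w : Fin (k + 1) → W}
    (h : SameKer u w) (t : Fin k) : IsFreshStep u t ↔ IsFreshStep w t :=
  forall_congr' fun j => imp_congr_right fun _ => not_congr (h j t.succ)

lemma isEvenWalk_iff {V : Type*} [DecidableEq V] {k : ℕ} (u : Fin (k + 1) → V) :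
    IsEvenWalk u ↔ u 0 = u (Fin.last k) ∧ ∀ i : Fin k, Even (Finset.univ.filter fun t : Fin k =>
      s(u t.castSucc, u t.succ) = s(u i.castSucc, u i.succ)).card := by
  refine and_congr_right fun _ => ⟨fun h i => h _, fun h e => ?_⟩
  by_cases he : ∃ i : Fin k, s(u i.castSucc, u i.succ) = e
  · obtain ⟨i, rfl⟩ := he
    exact h i
  · push Not at he
    rw [Finset.filter_eq_empty_iff.2 fun t _ => he t]
    simp

lemma SameKer.isEvenWalk_iff {V W : Type*} [DecidableEq V] [DecidableEq W] {k : ℕ}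
    {u : Fin (k + 1) → V} {w : Fin (k + 1) → W} (h : SameKer u w) :
    IsEvenWalk u ↔ IsEvenWalk w := by
  have : ∀ t i : Fin k, s(u t.castSucc, u t.succ) = s(u i.castSucc, u i.succ) ↔
      s(w t.castSucc, w t.succ) = s(w i.castSucc, w i.succ) := by
    intro t i
    simp only [Sym2.eq_iff, h _ _]
  rw [_root_.isEvenWalk_iff, _root_.isEvenWalk_iff, h _ _]
  simp only [this]

open Classical in
/-- The product of `f` over the fresh steps of a walk. -/
noncomputable def freshProd {V : Type*} (f : V → V → ℝ) {k : ℕ} (u : Fin (k + 1) → V) : ℝ :=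
  ∏ t : Fin k, if IsFreshStep u t then f (u t.castSucc) (u t.succ) else 1

open Classical in
lemma freshProd_snoc {V : Type*} (f : V → V → ℝ) {k : ℕ} (u : Fin (k + 1) → V) (a : V) :
    freshProd f (Fin.snoc u a : Fin (k + 2) → V) =
      freshProd f u * if ∀ j, u j ≠ a then f (u (Fin.last k)) a else 1 := by
  rw [freshProd, Fin.prod_univ_castSucc, freshProd]
  congr 1
  · refine Finset.prod_congr rfl fun t _ => ?_
    rw [Fin.snoc_castSucc, Fin.succ_castSucc, Fin.snoc_castSucc]
    have : IsFreshStep (Fin.snoc u a : Fin (k + 2) → V) t.castSucc ↔ IsFreshStep u t := by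
      rw [IsFreshStep, IsFreshStep, Fin.forall_fin_succ']
      simp only [Fin.castSucc_le_castSucc_iff, Fin.snoc_castSucc, Fin.succ_castSucc]
      refine and_iff_left fun h => ?_
      exact absurd (lt_of_lt_of_le (Fin.castSucc_lt_last _) h) (lt_irrefl _)
    simp only [this]
  · rw [Fin.snoc_castSucc, Fin.succ_last, Fin.snoc_last]
    have : IsFreshStep (Fin.snoc u a : Fin (k + 2) → V) (Fin.last k) ↔ ∀ j, u j ≠ a := by
      rw [IsFreshStep, Fin.forall_fin_succ']
      simp only [Fin.snoc_castSucc, Fin.succ_last, Fin.snoc_last, Fin.castSucc_le_castSucc_iff]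
      refine ⟨fun h j => h.1 j (Fin.le_last j), fun h => ⟨fun j _ => h j, fun h' => ?_⟩⟩
      exact absurd (lt_of_lt_of_le (Fin.castSucc_lt_last _) h') (lt_irrefl _)
    simp only [this]

lemma SameKer.freshProd_const {V W : Type*} {k : ℕ} {u : Fin (k + 1) → V} {w : Fin (k + 1) → W}
    (h : SameKer u w) (c : ℝ) : freshProd (fun _ _ => c) u = freshProd (fun _ _ => c) w := by
  classical
  refine Finset.prod_congr rfl fun t _ => ?_
  simp only [h.isFreshStep_iff]

lemma freshProd_nonneg {V : Type*} {f : V → V → ℝ} (hf : ∀ i j, 0 ≤ f i j) {k : ℕ}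
    (u : Fin (k + 1) → V) : 0 ≤ freshProd f u := by
  refine Finset.prod_nonneg fun t _ => ?_
  split_ifs
  exacts [hf _ _, zero_le_one]

lemma freshProd_pos {V : Type*} {f : V → V → ℝ} (hf : ∀ i j, 0 < f i j) {k : ℕ}
    (u : Fin (k + 1) → V) : 0 < freshProd f u := by
  refine Finset.prod_pos fun t _ => ?_
  split_ifs
  exacts [hf _ _, zero_lt_one]

lemma sameKer_snoc {V W : Type*} {k : ℕ} (u : Fin k → V) (w : Fin k → W) (a : V) (b : W) :
    SameKer (Fin.snoc u a : Fin (k + 1) → V) (Fin.snoc w b : Fin (k + 1) → W) ↔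
      SameKer u w ∧ ∀ i, u i = a ↔ w i = b := by
  simp only [SameKer, Fin.forall_fin_succ', Fin.snoc_castSucc, Fin.snoc_last, and_true,
    iff_self]
  constructor
  · rintro ⟨h, -⟩
    exact ⟨fun i j => (h i).1 j, fun i => (h i).2⟩
  · rintro ⟨h, h'⟩
    exact ⟨fun i => ⟨h i, h' i⟩, fun i => by rw [eq_comm, h' i, eq_comm]⟩

/-- Each fresh step of an even walk uses up at least two traversals of its edge. -/
lemma IsEvenWalk.walkWeight_le {V : Type*} [Fintype V] [DecidableEq V] {A : Matrix V V ℝ}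
    (hA : A.IsSymm) (h0 : ∀ i j, 0 ≤ A i j) (h1 : ∀ i j, A i j ≤ 1) {k : ℕ}
    {u : Fin (k + 1) → V} (hu : IsEvenWalk u) :
    walkWeight A u ≤ freshProd (fun i j => A i j ^ 2) u := by
  classical
  let a : Sym2 V → ℝ := Sym2.lift ⟨fun i j => A i j, fun i j => (hA.apply i j).symm⟩
  have ha0 : ∀ e, 0 ≤ a e := fun e => by
    induction e using Sym2.ind with | _ i j => exact h0 i j
  have ha1 : ∀ e, a e ≤ 1 := fun e => by
    induction e using Sym2.ind with | _ i j => exact h1 i j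
  let e : Fin k → Sym2 V := fun t => s(u t.castSucc, u t.succ)
  let F : Finset (Fin k) := Finset.univ.filter fun t => IsFreshStep u t
  have hlt : ∀ t t' : Fin k, IsFreshStep u t' → e t = e t' → ¬ t < t' := by
    intro t t' ht' he hlt
    have hs : t.succ ≤ t'.castSucc := Fin.castSucc_lt_iff_succ_le.1 hlt
    rcases Sym2.eq_iff.1 he with ⟨-, h⟩ | ⟨h, -⟩
    · exact ht' _ hs h
    · exact ht' _ (Fin.castSucc_le_castSucc_iff.2 hlt.le) h
  have hinj : Set.InjOn e F := by
    intro t ht t' ht' he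
    have h1 : IsFreshStep u t := (Finset.mem_filter.1 ht).2
    have h2 : IsFreshStep u t' := (Finset.mem_filter.1 ht').2
    exact le_antisymm (not_lt.1 (hlt t' t h1 he.symm)) (not_lt.1 (hlt t t' h2 he))
  have hL : walkWeight A u = ∏ E, a E ^ (Finset.univ.filter fun t => e t = E).card := by
    rw [walkWeight, ← Finset.prod_fiberwise Finset.univ e]
    refine Finset.prod_congr rfl fun E _ => ?_
    rw [Finset.prod_congr rfl (g := fun _ => a E), Finset.prod_const]
    intro t ht
    rw [← (Finset.mem_filter.1 ht).2]
    rfl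
  have hR : freshProd (fun i j => A i j ^ 2) u = ∏ E, if E ∈ F.image e then a E ^ 2 else 1 := by
    rw [Finset.prod_ite_mem, Finset.univ_inter, Finset.prod_image hinj, freshProd,
      Finset.prod_filter]
    refine Finset.prod_congr rfl fun t _ => ?_
    congr 1
  rw [hL, hR]
  refine Finset.prod_le_prod (fun E _ => pow_nonneg (ha0 E) _) fun E _ => ?_
  split_ifs with hE
  · obtain ⟨t, -, rfl⟩ := Finset.mem_image.1 hE
    refine pow_le_pow_of_le_one (ha0 _) (ha1 _) ?_
    have hpos : 0 < (Finset.univ.filter fun t' => e t' = e t).card :=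
      Finset.card_pos.2 ⟨t, by simp⟩
    obtain ⟨m, hm⟩ := hu.2 (e t)
    change (Finset.univ.filter fun t' => e t' = e t).card = m + m at hm
    omega
  · exact pow_le_one₀ (ha0 _) (ha1 _)

open Classical in
lemma sum_sameKer_freshProd_le {n : ℕ} {W : Type*} {f : Fin n → Fin n → ℝ} {P : ℝ}
    (hf : ∀ i j, 0 ≤ f i j) (hP : ∀ i, ∑ j, f i j ≤ P) {k : ℕ} (w : Fin (k + 1) → W) :
    ∑ u : Fin (k + 1) → Fin n, (if SameKer u w then freshProd f u else 0) ≤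
      n * freshProd (fun _ _ => P) w := by
  induction k with
  | zero =>
    have h1 : ∀ u : Fin 1 → Fin n, (if SameKer u w then freshProd f u else 0) ≤ 1 := by
      intro u
      split_ifs <;> simp [freshProd]
    refine (Finset.sum_le_sum fun u _ => h1 u).trans ?_
    simp [freshProd]
  | succ k ih =>
    obtain ⟨w, b, rfl⟩ : ∃ (w' : Fin (k + 1) → W) (b : W), w = Fin.snoc w' b :=
      ⟨Fin.init w, w (Fin.last _), (Fin.snoc_init_self w).symm⟩
    rw [freshProd_snoc, ← mul_assoc, sum_fin_succ_fun]
    have hc0 : 0 ≤ (if ∀ j, w j ≠ b then P else 1) ∨ n = 0 := by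
      rcases Nat.eq_zero_or_pos n with h | h
      · exact Or.inr h
      · left
        split_ifs
        · exact (Finset.sum_nonneg fun j _ => hf ⟨0, h⟩ j).trans (hP ⟨0, h⟩)
        · exact zero_le_one
    rcases hc0 with hc0 | rfl
    swap
    · have : IsEmpty (Fin (k + 1) → Fin 0) := ⟨fun u => (u 0).elim0⟩
      simp
    refine le_trans ?_ (mul_le_mul_of_nonneg_right (ih w) hc0)
    rw [Finset.sum_mul]
    refine Finset.sum_le_sum fun u _ => ?_
    simp only [sameKer_snoc, freshProd_snoc]
    by_cases hk : SameKer u w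
    swap
    · simp [hk]
    simp only [hk, true_and, if_true]
    refine le_trans (b := freshProd f u * ∑ a, if ∀ i, u i = a ↔ w i = b then
      (if ∀ j, u j ≠ a then f (u (Fin.last k)) a else 1) else 0) ?_ ?_
    · rw [Finset.mul_sum]
      refine Finset.sum_le_sum fun a _ => ?_
      split_ifs <;> simp
    refine mul_le_mul_of_nonneg_left ?_ (freshProd_nonneg hf u)
    by_cases hb : ∀ j, w j ≠ b
    · rw [if_pos hb]
      refine le_trans (Finset.sum_le_sum fun a _ => ?_) (hP (u (Fin.last k)))
      by_cases hi : ∀ i, u i = a ↔ w i = b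
      · rw [if_pos hi, if_pos fun j => (not_congr (hi j)).2 (hb j)]
      · rw [if_neg hi]; exact hf _ _
    · rw [if_neg hb]
      push Not at hb
      obtain ⟨j, hj⟩ := hb
      refine le_trans (Finset.sum_le_sum (g := fun a => if a = u j then (1 : ℝ) else 0)
        fun a _ => ?_) (by simp)
      by_cases hi : ∀ i, u i = a ↔ w i = b
      · have ha : u j = a := (hi j).2 hj
        rw [if_pos hi, if_neg fun h => h j ha, if_pos ha.symm]
      · rw [if_neg hi]; split_ifs <;> norm_num

open Classical in
lemma le_sum_sameKer {V : Type*} {p r k : ℕ} (hr : k + p ≤ r) (u : Fin (k + 1) → V) :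
    r * freshProd (fun _ _ => (p : ℝ)) u ≤
      ∑ w : Fin (k + 1) → Fin r, if SameKer u w then (1 : ℝ) else 0 := by
  induction k with
  | zero =>
    have h1 : ∀ w : Fin 1 → Fin r, SameKer u w := fun w i j => by
      rw [Subsingleton.elim (α := Fin 1) i j]
      simp
    simp [h1, freshProd]
  | succ k ih =>
    obtain ⟨u, a, rfl⟩ : ∃ (u' : Fin (k + 1) → V) (a : V), u = Fin.snoc u' a :=
      ⟨Fin.init u, u (Fin.last _), (Fin.snoc_init_self u).symm⟩
    rw [freshProd_snoc, ← mul_assoc, sum_fin_succ_fun]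
    refine (mul_le_mul_of_nonneg_right (ih (by omega) u) (by split_ifs <;> positivity)).trans ?_
    rw [Finset.sum_mul]
    refine Finset.sum_le_sum fun w _ => ?_
    simp only [sameKer_snoc]
    by_cases hk : SameKer u w
    swap
    · simp [hk]
    simp only [hk, true_and, if_true, one_mul]
    rw [← Finset.sum_filter, Finset.sum_const, nsmul_eq_mul, mul_one]
    by_cases ha : ∀ j, u j ≠ a
    · rw [if_pos ha]
      have hsub : (Finset.univ.image w)ᶜ ⊆
          Finset.univ.filter fun b => ∀ i, u i = a ↔ w i = b := by
        intro b hb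
        simp only [Finset.mem_compl, Finset.mem_image, Finset.mem_univ, true_and, not_exists] at hb
        simp only [Finset.mem_filter, Finset.mem_univ, true_and]
        exact fun i => iff_of_false (ha i) (hb i)
      have h1 := Finset.card_le_card hsub
      have h2 : (Finset.univ.image w).card ≤ k + 1 := by
        simpa using Finset.card_image_le (s := Finset.univ) (f := w)
      rw [Finset.card_compl, Fintype.card_fin] at h1
      exact_mod_cast (by omega : p ≤ _)
    · rw [if_neg ha]
      push Not at ha
      obtain ⟨j, hj⟩ := ha
      have : 0 < (Finset.univ.filter fun b => ∀ i, u i = a ↔ w i = b).card := by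
        refine Finset.card_pos.2 ⟨w j, ?_⟩
        simp only [Finset.mem_filter, Finset.mem_univ, true_and]
        intro i
        rw [← hj]
        exact hk i j
      exact_mod_cast this

open Classical in
/-- Even walks weighted by a matrix with small entries and bounded row norms, compared with even
walks on a complete graph. -/
lemma sum_isEvenWalk_le {n p r k : ℕ} (hp : 0 < p) (hr : k + p ≤ r)
    {A : Matrix (Fin n) (Fin n) ℝ} (hA : A.IsSymm) (h0 : ∀ i j, 0 ≤ A i j) (h1 : ∀ i j, A i j ≤ 1)
    (hrow : ∀ i, ∑ j, A i j ^ 2 ≤ p) :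
    r * ∑ u : Fin (k + 1) → Fin n, (if IsEvenWalk u then walkWeight A u else 0) ≤
      n * ∑ w : Fin (k + 1) → Fin r, if IsEvenWalk w then 1 else 0 := by
  have hp' : (0 : ℝ) < p := by exact_mod_cast hp
  set F : (Fin (k + 1) → Fin n) → ℝ := freshProd fun i j => A i j ^ 2
  have hF : ∀ u, 0 ≤ F u := fun u => freshProd_nonneg (fun i j => sq_nonneg _) u
  set c : (Fin (k + 1) → Fin n) → ℝ := freshProd fun _ _ => (p : ℝ)
  have hc : ∀ u, 0 < c u := fun u => freshProd_pos (fun _ _ => hp') u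
  calc _ ≤ ∑ u : Fin (k + 1) → Fin n, (if IsEvenWalk u then F u / c u * (r * c u) else 0) := by
        rw [Finset.mul_sum]
        refine Finset.sum_le_sum fun u _ => ?_
        split_ifs with hu
        · rw [mul_left_comm, div_mul_cancel₀ _ (hc u).ne']
          exact mul_le_mul_of_nonneg_left (hu.walkWeight_le hA h0 h1) (by positivity)
        · simp
    _ ≤ ∑ u : Fin (k + 1) → Fin n, ∑ w : Fin (k + 1) → Fin r,
          (if IsEvenWalk u ∧ SameKer u w then F u / c u else 0) := by
        refine Finset.sum_le_sum fun u _ => ?_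
        by_cases hu : IsEvenWalk u
        · simp only [hu, if_true, true_and]
          refine (mul_le_mul_of_nonneg_left (le_sum_sameKer hr u)
            (div_nonneg (hF u) (hc u).le)).trans (le_of_eq ?_)
          rw [Finset.mul_sum]
          exact Finset.sum_congr rfl fun w _ => by rw [mul_ite, mul_one, mul_zero]
        · simp [hu]
    _ = ∑ w : Fin (k + 1) → Fin r, if IsEvenWalk w then
          (∑ u : Fin (k + 1) → Fin n, if SameKer u w then F u else 0) /
            freshProd (fun _ _ => (p : ℝ)) w else 0 := by
        rw [Finset.sum_comm]
        refine Finset.sum_congr rfl fun w _ => ?_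
        rw [Finset.sum_div]
        split_ifs with hw
        · refine Finset.sum_congr rfl fun u _ => ?_
          by_cases hk : SameKer u w
          · rw [if_pos ⟨hk.isEvenWalk_iff.2 hw, hk⟩, if_pos hk, ← hk.freshProd_const]
          · simp [hk]
        · refine Finset.sum_eq_zero fun u _ => if_neg ?_
          rintro ⟨hu, hk⟩
          exact hw (hk.isEvenWalk_iff.1 hu)
    _ ≤ _ := by
        rw [Finset.mul_sum]
        refine Finset.sum_le_sum fun w _ => ?_
        split_ifs with hw
        · rw [div_le_iff₀ (freshProd_pos (fun _ _ => hp') w), mul_one]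
          exact sum_sameKer_freshProd_le (fun i j => sq_nonneg _) hrow w
        · simp

/-! ### Norms of sign matrices -/

lemma sum_norm_signMatrix_pow_le {n k : ℕ} {A : Matrix (Fin n) (Fin n) ℝ} (hA : A.IsSymm)
    (h0 : ∀ i j, 0 ≤ A i j) (h1 : ∀ i j, A i j ≤ 1)
    (hrow : ∀ i, ∑ j, A i j ^ 2 ≤ (2 : ℝ) ^ k) :
    ∑ s : Sym2 (Fin n) → Bool, matrixSpectralNorm (signMatrix A s) ^ (2 * 2 ^ k) ≤
      2 ^ Fintype.card (Sym2 (Fin n)) * (n * (8000000 * 2 ^ k) ^ 2 ^ k) := by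
  classical
  set p : ℕ := 2 ^ k with hpdef
  have hp : 0 < p := by positivity
  have hpc : (p : ℝ) = 2 ^ k := by simp [hpdef]
  set r : ℕ := 3 * p with hr
  have hr0 : (0 : ℝ) < r := by positivity
  have hmono := sum_isEvenWalk_le (k := 2 * p) (r := r) hp (by omega) hA h0 h1
    (by simpa only [hpc] using hrow)
  have hone : ∀ w : Fin (2 * p + 1) → Fin r, walkWeight (fun _ _ => (1 : ℝ)) w = 1 :=
    fun w => by simp [walkWeight]
  set Nr : ℝ := 2 ^ Fintype.card (Sym2 (Fin r)) with hNr
  have hNr0 : 0 < Nr := by positivity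
  have hcomplete : Nr * ∑ w : Fin (2 * p + 1) → Fin r, (if IsEvenWalk w then (1 : ℝ) else 0) ≤
      r * (Nr * (16 ^ p * (25 ^ r * (2 * (16 * p) ^ p)))) := by
    have h2 := sum_trace_signMatrix_pow (fun _ _ : Fin r => (1 : ℝ)) (2 * p)
    simp only [hone] at h2
    rw [hNr, ← h2]
    calc _ ≤ ∑ s : Sym2 (Fin r) → Bool,
          r * matrixSpectralNorm (signMatrix (fun _ _ => 1) s) ^ (2 * p) :=
          Finset.sum_le_sum fun s _ => trace_pow_le _ (by omega)
      _ ≤ _ := by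
          rw [← Finset.mul_sum]
          exact mul_le_mul_of_nonneg_left (sum_norm_rademacher_pow_le r hp) hr0.le
  set D : ℝ := 16 ^ p * (25 ^ r * (2 * (16 * p) ^ p)) with hD
  have hDle : D ≤ (8000000 * p) ^ p := by
    have h2 : (2 : ℝ) ≤ 2 ^ p := le_self_pow₀ one_le_two hp.ne'
    calc D ≤ 16 ^ p * (25 ^ r * (2 ^ p * (16 * p) ^ p)) := by rw [hD]; gcongr
      _ = _ := by
        rw [hr, pow_mul, ← mul_pow, ← mul_pow, ← mul_pow]
        congr 1
        ring
  have hcomplete' : ∑ w : Fin (2 * p + 1) → Fin r, (if IsEvenWalk w then (1 : ℝ) else 0) ≤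
      r * D := by
    refine le_of_mul_le_mul_left (hcomplete.trans (le_of_eq ?_)) hNr0
    ring
  have hwalk : ∑ u : Fin (2 * p + 1) → Fin n, (if IsEvenWalk u then walkWeight A u else 0) ≤
      n * D := by
    refine le_of_mul_le_mul_left (hmono.trans ?_) hr0
    calc _ ≤ (n : ℝ) * (r * D) := by gcongr
      _ = _ := by ring
  calc _ ≤ ∑ s : Sym2 (Fin n) → Bool, (signMatrix A s ^ (2 * p)).trace :=
        Finset.sum_le_sum fun s _ => matrixSpectralNorm_pow_le_trace (signMatrix_isSymm hA s) k
    _ ≤ _ := by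
        rw [sum_trace_signMatrix_pow, ← hpc]
        gcongr
        exact hwalk.trans (by gcongr)

lemma sum_norm_signMatrix_le_of_le_one {n k : ℕ} (hn : (n : ℝ) ≤ Real.exp (2 ^ k))
    {A : Matrix (Fin n) (Fin n) ℝ} (hA : A.IsSymm)
    (h0 : ∀ i j, 0 ≤ A i j) (h1 : ∀ i j, A i j ≤ 1)
    (hrow : ∀ i, ∑ j, A i j ^ 2 ≤ (2 : ℝ) ^ k) :
    ∑ s : Sym2 (Fin n) → Bool, matrixSpectralNorm (signMatrix A s) ≤
      2 ^ Fintype.card (Sym2 (Fin n)) * (5000 * √(2 ^ k)) := by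
  set N : ℝ := 2 ^ Fintype.card (Sym2 (Fin n)) with hN
  have hN0 : 0 < N := by positivity
  have hmean := Real.pow_arith_mean_le_arith_mean_pow Finset.univ
    (fun _ : Sym2 (Fin n) → Bool => N⁻¹) (fun s => matrixSpectralNorm (signMatrix A s))
    (fun _ _ => by positivity) (by simp [hN]) (fun s _ => matrixSpectralNorm_nonneg _) (2 * 2 ^ k)
  rw [← Finset.mul_sum, ← Finset.mul_sum] at hmean
  have hle : N⁻¹ * ∑ s : Sym2 (Fin n) → Bool, matrixSpectralNorm (signMatrix A s) ^ (2 * 2 ^ k) ≤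
      (5000 * √(2 ^ k)) ^ (2 * 2 ^ k) := by
    rw [inv_mul_le_iff₀ hN0]
    refine (sum_norm_signMatrix_pow_le hA h0 h1 hrow).trans ?_
    rw [← hN]
    gcongr
    have hn3 : (n : ℝ) ≤ 3 ^ 2 ^ k := by
      calc (n : ℝ) ≤ Real.exp (2 ^ k) := hn
        _ = Real.exp 1 ^ 2 ^ k := by rw [← Real.exp_nat_mul]; simp
        _ ≤ _ := by
          gcongr
          linarith [Real.exp_one_lt_d9]
    calc (n : ℝ) * (8000000 * 2 ^ k) ^ 2 ^ k ≤ 3 ^ 2 ^ k * (8000000 * 2 ^ k) ^ 2 ^ k := by gcongr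
      _ = (24000000 * 2 ^ k) ^ 2 ^ k := by rw [← mul_pow]; ring_nf
      _ ≤ (25000000 * 2 ^ k) ^ 2 ^ k := by gcongr; norm_num
      _ = _ := by
        rw [pow_mul, mul_pow 5000, Real.sq_sqrt (by positivity)]
        norm_num
  have := le_of_pow_le_pow_left₀ (by positivity) (by positivity) (hmean.trans hle)
  rwa [inv_mul_le_iff₀ hN0] at this

/-- The norm of a sign matrix is at most of order `(log n) ^ (1 / 4)` times the largest row norm,
on average over the signs. -/
lemma sum_norm_signMatrix_le {n : ℕ} (hn : 2 ≤ n) {B : Matrix (Fin n) (Fin n) ℝ} (hB : B.IsSymm)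
    (h0 : ∀ i j, 0 ≤ B i j) {S : ℝ} (hS : 0 ≤ S) (hrow : ∀ i, ∑ j, B i j ^ 2 ≤ S ^ 2) :
    ∑ s : Sym2 (Fin n) → Bool, matrixSpectralNorm (signMatrix B s) ≤
      2 ^ Fintype.card (Sym2 (Fin n)) * (10001 * S * Real.log n ^ (1 / 4 : ℝ)) := by
  set L : ℝ := Real.log n with hL
  have hn' : (2 : ℝ) ≤ n := by exact_mod_cast hn
  have hL2 : 1 ≤ 2 * L := by
    have := Real.log_two_gt_d9
    have := Real.log_le_log (by norm_num) hn'
    linarith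
  have hL0 : 0 < L := by linarith
  set q : ℝ := L ^ (1 / 4 : ℝ) with hq
  have hq0 : 0 < q := Real.rpow_pos_of_pos hL0 _
  have hq4 : q ^ 4 = L := by
    rw [hq, ← Real.rpow_natCast, ← Real.rpow_mul hL0.le]
    norm_num
  rcases hS.eq_or_lt with rfl | hS0
  · have hz : ∀ i j, B i j = 0 := by
      intro i j
      have h1 := Finset.single_le_sum (f := fun j => B i j ^ 2) (fun j _ => sq_nonneg _)
        (Finset.mem_univ j)
      have h2 : B i j ^ 2 ≤ 0 := by simpa using h1.trans (hrow i)
      exact pow_eq_zero_iff two_ne_zero |>.1 (le_antisymm h2 (sq_nonneg _))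
    have : ∀ s, signMatrix B s = 0 := by
      intro s
      ext i j
      simp [signMatrix, hz]
    simp [this, matrixSpectralNorm]
  obtain ⟨k, hk1, hk2⟩ := exists_nat_pow_near hL2 (one_lt_two : (1 : ℝ) < 2)
  have hLk : L ≤ 2 ^ k := by rw [pow_succ] at hk2; linarith
  set P : ℝ := 2 ^ k with hP
  have hP1 : 1 ≤ P := one_le_pow₀ one_le_two
  set δ : ℝ := S / q with hδ
  have hδ0 : 0 < δ := by positivity
  let A : Matrix (Fin n) (Fin n) ℝ := fun i j => if B i j ≤ δ then B i j / δ else 0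
  let B' : Matrix (Fin n) (Fin n) ℝ := fun i j => if B i j ≤ δ then 0 else B i j
  have hB'0 : ∀ i j, 0 ≤ B' i j := fun i j => by
    simp only [B']; split_ifs
    exacts [le_rfl, h0 i j]
  have hsmall := sum_norm_signMatrix_le_of_le_one (k := k) (A := A)
    (by rw [← Real.log_le_iff_le_exp (by linarith)]; exact hLk)
    (by ext i j; rw [Matrix.transpose_apply]; simp only [A, hB.apply i j])
    (fun i j => by simp only [A]; split_ifs <;> [exact div_nonneg (h0 i j) hδ0.le; exact le_rfl])
    (fun i j => by
      simp only [A]; split_ifs with h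
      · exact (div_le_one hδ0).2 h
      · exact zero_le_one)
    (fun i => by
      calc ∑ j, A i j ^ 2 ≤ ∑ j, B i j ^ 2 / δ ^ 2 := by
            refine Finset.sum_le_sum fun j _ => ?_
            simp only [A]; split_ifs
            · rw [div_pow]
            · rw [zero_pow two_ne_zero]; positivity
        _ = (∑ j, B i j ^ 2) / δ ^ 2 := by rw [Finset.sum_div]
        _ ≤ S ^ 2 / δ ^ 2 := by gcongr; exact hrow i
        _ = q ^ 2 := by rw [hδ, div_pow, div_div_cancel₀ (by positivity)]
        _ ≤ P := by nlinarith [sq_nonneg (q ^ 2 - P)])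
  have hlarge : ∀ s, matrixSpectralNorm (signMatrix B' s) ≤ S * q := by
    intro s
    have habs : ∀ i j, |signMatrix B' s i j| = B' i j := by
      intro i j
      rw [signMatrix, abs_mul, abs_of_nonneg (hB'0 i j), boolSign]
      split_ifs <;> simp
    refine matrixSpectralNorm_le_of_row_sum _ (by positivity) (fun i j => ?_) fun i => ?_
    · rw [habs, habs]; simp only [B', hB.apply i j]
    · simp only [habs]
      calc ∑ j, B' i j ≤ ∑ j, B i j ^ 2 / δ := by
            refine Finset.sum_le_sum fun j _ => ?_
            simp only [B']; split_ifs with h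
            · positivity
            · rw [le_div_iff₀ hδ0, sq]
              exact mul_le_mul_of_nonneg_left (not_le.1 h).le (h0 i j)
        _ = (∑ j, B i j ^ 2) / δ := by rw [Finset.sum_div]
        _ ≤ S ^ 2 / δ := by gcongr; exact hrow i
        _ = S * q := by rw [hδ]; field_simp
  have hsplit : ∀ s, matrixSpectralNorm (signMatrix B s) ≤
      δ * matrixSpectralNorm (signMatrix A s) + S * q := by
    intro s
    have : signMatrix B s = δ • signMatrix A s + signMatrix B' s := by
      ext i j
      simp only [Matrix.add_apply, Matrix.smul_apply, signMatrix, A, B', smul_eq_mul]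
      split_ifs
      · rw [zero_mul, add_zero, ← mul_assoc, mul_div_cancel₀ _ hδ0.ne']
      · ring
    rw [this]
    calc _ ≤ matrixSpectralNorm (δ • signMatrix A s) + matrixSpectralNorm (signMatrix B' s) := by
          simp only [matrixSpectralNorm, map_add]
          exact norm_add_le _ _
      _ ≤ _ := by
          refine add_le_add (le_of_eq ?_) (hlarge s)
          simp only [matrixSpectralNorm, map_smul, norm_smul, Real.norm_of_nonneg hδ0.le]
  have hδP : δ * √P ≤ 2 * (S * q) := by
    have h1 : √P ≤ 2 * q ^ 2 := by
      rw [Real.sqrt_le_left (by positivity)]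
      nlinarith
    calc δ * √P ≤ δ * (2 * q ^ 2) := by gcongr
      _ = _ := by rw [hδ]; field_simp
  calc _ ≤ ∑ s : Sym2 (Fin n) → Bool, (δ * matrixSpectralNorm (signMatrix A s) + S * q) :=
        Finset.sum_le_sum fun s _ => hsplit s
    _ = δ * ∑ s : Sym2 (Fin n) → Bool, matrixSpectralNorm (signMatrix A s) +
        2 ^ Fintype.card (Sym2 (Fin n)) * (S * q) := by
        rw [Finset.sum_add_distrib, ← Finset.mul_sum, Finset.sum_const, nsmul_eq_mul]
        simp
    _ ≤ δ * (2 ^ Fintype.card (Sym2 (Fin n)) * (5000 * √P)) +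
        2 ^ Fintype.card (Sym2 (Fin n)) * (S * q) := by gcongr
    _ = 2 ^ Fintype.card (Sym2 (Fin n)) * (5000 * (δ * √P) + S * q) := by ring
    _ ≤ _ := by
        gcongr
        linarith

/-! ### Reduction of bounded centred entries to signs -/

lemma sum_prod_bias_mul_boolSign {ι : Type*} [Fintype ι] [DecidableEq ι] (q : ι → ℝ) (e : ι) :
    ∑ s : ι → Bool, (∏ i, (1 + boolSign (s i) * q i) / 2) * boolSign (s e) = q e := by
  have h : ∀ s : ι → Bool, (∏ i, (1 + boolSign (s i) * q i) / 2) * boolSign (s e) =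
      ∏ i, ((1 + boolSign (s i) * q i) / 2 * if i = e then boolSign (s i) else 1) := by
    intro s
    rw [Finset.prod_mul_distrib, Finset.prod_ite_eq' Finset.univ e]
    simp
  simp_rw [h]
  rw [sum_prod_bool (fun i b => (1 + boolSign b * q i) / 2 * if i = e then boolSign b else 1),
    Finset.prod_eq_single e]
  · simp [boolSign]; ring
  · intro i _ hi
    simp [boolSign, hi]; ring
  · simp

/-- The normalized entry of `M` at an unordered pair of indices. -/
noncomputable def entryRatio {n : ℕ} (M B : Matrix (Fin n) (Fin n) ℝ) (e : Sym2 (Fin n)) : ℝ :=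
  M e.inf e.sup / B e.inf e.sup

/-- The probability of the sign pattern `s` when the signs are independent with means
`entryRatio M B`. -/
noncomputable def signWeight {n : ℕ} (M B : Matrix (Fin n) (Fin n) ℝ) (s : Sym2 (Fin n) → Bool) :
    ℝ :=
  ∏ e, (1 + boolSign (s e) * entryRatio M B e) / 2

section
variable {n : ℕ} {M B : Matrix (Fin n) (Fin n) ℝ}

lemma abs_boolSign_mul_entryRatio_le (h : ∀ i j, |M i j| ≤ B i j) (b : Bool) (e : Sym2 (Fin n)) :
    |boolSign b * entryRatio M B e| ≤ 1 := by
  have h1 : |boolSign b| = 1 := by rw [boolSign]; split_ifs <;> simp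
  rw [abs_mul, h1, one_mul, entryRatio, abs_div,
    abs_of_nonneg ((abs_nonneg _).trans (h e.inf e.sup))]
  exact div_le_one_of_le₀ (h _ _) ((abs_nonneg _).trans (h _ _))

lemma signWeight_nonneg (h : ∀ i j, |M i j| ≤ B i j) (s : Sym2 (Fin n) → Bool) :
    0 ≤ signWeight M B s :=
  Finset.prod_nonneg fun e _ => by
    have := (abs_le.1 (abs_boolSign_mul_entryRatio_le h (s e) e)).1
    linarith

lemma signWeight_le_one (h : ∀ i j, |M i j| ≤ B i j) (s : Sym2 (Fin n) → Bool) :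
    signWeight M B s ≤ 1 :=
  Finset.prod_le_one
    (fun e _ => by
      have := (abs_le.1 (abs_boolSign_mul_entryRatio_le h (s e) e)).1
      linarith)
    (fun e _ => by
      have := (abs_le.1 (abs_boolSign_mul_entryRatio_le h (s e) e)).2
      linarith)

lemma eq_sum_signWeight_smul (hM : M.IsSymm) (hB : B.IsSymm) (h : ∀ i j, |M i j| ≤ B i j) :
    M = ∑ s, signWeight M B s • signMatrix B s := by
  ext i j
  have hq : entryRatio M B s(i, j) = M i j / B i j := by
    rcases le_total i j with hij | hij
    · simp [entryRatio, hij]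
    · simp [entryRatio, hij, hM.apply i j, hB.apply i j]
  have h1 : ∑ s, signWeight M B s * boolSign (s s(i, j)) = M i j / B i j := by
    rw [← hq]
    exact sum_prod_bias_mul_boolSign (entryRatio M B) s(i, j)
  rw [Matrix.sum_apply]
  simp only [Matrix.smul_apply, signMatrix, smul_eq_mul]
  calc M i j = B i j * (M i j / B i j) := by
        rw [mul_div_cancel_of_imp']
        intro h0
        have := h i j
        rw [h0] at this
        exact abs_eq_zero.1 (le_antisymm this (abs_nonneg _))
    _ = _ := by
        rw [← h1, Finset.mul_sum]
        exact Finset.sum_congr rfl fun s _ => by ring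

lemma matrixSpectralNorm_le_sum_signWeight (hM : M.IsSymm) (hB : B.IsSymm)
    (h : ∀ i j, |M i j| ≤ B i j) :
    matrixSpectralNorm M ≤ ∑ s, signWeight M B s * matrixSpectralNorm (signMatrix B s) := by
  have h1 : matrixSpectralNorm M =
      matrixSpectralNorm (∑ s, signWeight M B s • signMatrix B s) := by
    rw [← eq_sum_signWeight_smul hM hB h]
  rw [h1]
  simp only [matrixSpectralNorm, map_sum, map_smul]
  refine (norm_sum_le _ _).trans (Finset.sum_le_sum fun s _ => ?_)
  rw [norm_smul, Real.norm_of_nonneg (signWeight_nonneg h s)]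

end

section
variable {n : ℕ} {Ω : Type*} [MeasurableSpace Ω] {μ : Measure Ω}
  {X : Ω → Matrix (Fin n) (Fin n) ℝ}

lemma measurable_entryRatio (hX : IsIndepSymmRandomMatrix X μ) (B : Matrix (Fin n) (Fin n) ℝ)
    (e : Sym2 (Fin n)) : Measurable fun ω => entryRatio (X ω) B e :=
  (hX.measurable _ _).div_const _

lemma measurable_signWeight (hX : IsIndepSymmRandomMatrix X μ) (B : Matrix (Fin n) (Fin n) ℝ)
    (s : Sym2 (Fin n) → Bool) : Measurable fun ω => signWeight (X ω) B s :=
  Finset.measurable_fun_prod _ fun e _ =>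
    ((measurable_const.add ((measurable_entryRatio hX B e).const_mul _)).div_const _)

lemma aestronglyMeasurable_matrixSpectralNorm (hX : IsIndepSymmRandomMatrix X μ) :
    AEStronglyMeasurable (fun ω => matrixSpectralNorm (X ω)) μ := by
  have h : ∀ ω, Matrix.toEuclideanCLM (n := Fin n) (𝕜 := ℝ) (X ω) =
      ∑ i, ∑ j, X ω i j • Matrix.toEuclideanCLM (n := Fin n) (𝕜 := ℝ) (Matrix.single i j 1) := by
    intro ω
    conv_lhs => rw [Matrix.matrix_eq_sum_single (X ω)]
    simp only [map_sum, ← map_smul, Matrix.smul_single, smul_eq_mul, mul_one]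
  simp only [matrixSpectralNorm, h]
  refine AEStronglyMeasurable.norm ?_
  refine Finset.aestronglyMeasurable_fun_sum _ fun i _ =>
    Finset.aestronglyMeasurable_fun_sum _ fun j _ => ?_
  exact ((hX.measurable i j).stronglyMeasurable.smul_const _).aestronglyMeasurable

variable [IsProbabilityMeasure μ]

lemma integral_signWeight (hX : IsIndepSymmRandomMatrix X μ)
    (hint : ∀ i j, Integrable (fun ω => X ω i j) μ)
    (hmean : ∀ i j, ∫ ω, X ω i j ∂μ = 0) (B : Matrix (Fin n) (Fin n) ℝ)
    (s : Sym2 (Fin n) → Bool) :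
    ∫ ω, signWeight (X ω) B s ∂μ = (2 ^ Fintype.card (Sym2 (Fin n)))⁻¹ := by
  have hind : iIndepFun (fun (e : Sym2 (Fin n)) ω =>
      (1 + boolSign (s e) * entryRatio (X ω) B e) / 2) μ := by
    have h1 : iIndepFun (fun (e : Sym2 (Fin n)) ω => X ω e.inf e.sup) μ :=
      hX.indep.precomp (g := Sym2.sortEquiv) Sym2.sortEquiv.injective
    exact h1.comp (fun e x => (1 + boolSign (s e) * (x / B e.inf e.sup)) / 2)
      fun e => by fun_prop
  simp only [signWeight]
  rw [hind.integral_fun_prod_eq_prod_integral fun e =>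
    ((measurable_const.add ((measurable_entryRatio hX B e).const_mul _)).div_const
      _).aestronglyMeasurable]
  rw [Finset.prod_congr rfl (g := fun _ => (2 : ℝ)⁻¹)]
  · simp
  · intro e _
    have h2 : Integrable (fun ω => boolSign (s e) * entryRatio (X ω) B e) μ :=
      ((hint _ _).div_const _).const_mul _
    rw [integral_div, integral_add (integrable_const _) h2, integral_const_mul]
    simp only [entryRatio]
    rw [integral_div, hmean]
    simp

/-- Among independent centred entries bounded by `B`, random signs maximize the mean norm. -/
lemma integrable_and_integral_le_sum_signMatrix (hX : IsIndepSymmRandomMatrix X μ)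
    (hmean : ∀ i j, ∫ ω, X ω i j ∂μ = 0) {B : Matrix (Fin n) (Fin n) ℝ} (hB : B.IsSymm)
    (hXB : ∀ᵐ ω ∂μ, ∀ i j, |X ω i j| ≤ B i j) :
    Integrable (fun ω => matrixSpectralNorm (X ω)) μ ∧
      ∫ ω, matrixSpectralNorm (X ω) ∂μ ≤ (2 ^ Fintype.card (Sym2 (Fin n)))⁻¹ *
        ∑ s, matrixSpectralNorm (signMatrix B s) := by
  have hint : ∀ i j, Integrable (fun ω => X ω i j) μ := fun i j =>
    Integrable.of_bound (hX.measurable i j).aestronglyMeasurable (B i j)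
      (hXB.mono fun ω h => h i j)
  have hle : ∀ᵐ ω ∂μ, matrixSpectralNorm (X ω) ≤
      ∑ s, signWeight (X ω) B s * matrixSpectralNorm (signMatrix B s) :=
    hXB.mono fun ω h => matrixSpectralNorm_le_sum_signWeight (hX.symm ω) hB h
  have hw : ∀ s, Integrable (fun ω => signWeight (X ω) B s) μ := fun s =>
    Integrable.of_bound (measurable_signWeight hX B s).aestronglyMeasurable 1
      (hXB.mono fun ω h => by
        rw [Real.norm_of_nonneg (signWeight_nonneg h s)]
        exact signWeight_le_one h s)
  have hsum : Integrable
      (fun ω => ∑ s, signWeight (X ω) B s * matrixSpectralNorm (signMatrix B s)) μ :=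
    integrable_finsetSum _ fun s _ => (hw s).mul_const _
  have hi : Integrable (fun ω => matrixSpectralNorm (X ω)) μ :=
    hsum.mono' (aestronglyMeasurable_matrixSpectralNorm hX) (hle.mono fun ω h => by
      rwa [Real.norm_of_nonneg (matrixSpectralNorm_nonneg _)])
  refine ⟨hi, (integral_mono_ae hi hsum hle).trans (le_of_eq ?_)⟩
  rw [integral_finsetSum _ fun s _ => (hw s).mul_const _, Finset.mul_sum]
  refine Finset.sum_congr rfl fun s _ => ?_
  rw [integral_mul_const, integral_signWeight hX hint hmean]

end

theorem mainTheorem10 :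
    ∃ C : ℝ, 0 < C ∧
      ∀ (n : ℕ), 2 ≤ n →
      ∀ (Ω : Type*) [MeasurableSpace Ω] (μ : Measure Ω) [IsProbabilityMeasure μ]
        (X : Ω → Matrix (Fin n) (Fin n) ℝ) (b : Fin n → Fin n → ℝ) (K : ℝ),
        0 < K →
        IsIndepSymmRandomMatrix X μ →
        (∀ i j, ∫ ω, X ω i j ∂μ = 0) →
        (∀ i j, ∀ᵐ ω ∂μ, |X ω i j| ≤ K * b i j) →
        Integrable (fun ω => matrixSpectralNorm (X ω)) μ ∧
          ∫ ω, matrixSpectralNorm (X ω) ∂μ ≤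
            C * K * (⨆ i : Fin n, √(∑ j : Fin n, b i j ^ 2)) * Real.log n ^ (1 / 4 : ℝ) := by
  refine ⟨10001, by norm_num, fun n hn Ω _ μ _ X b K hK hX hmean hb => ?_⟩
  have hb0 : ∀ i j, 0 ≤ b i j := by
    intro i j
    obtain ⟨ω, hω⟩ := (hb i j).exists
    exact nonneg_of_mul_nonneg_right ((abs_nonneg _).trans hω) hK
  let B : Matrix (Fin n) (Fin n) ℝ := fun i j => K * min (b i j) (b j i)
  have hB : B.IsSymm := by
    ext i j
    rw [Matrix.transpose_apply]
    simp only [B, min_comm]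
  have hB0 : ∀ i j, 0 ≤ B i j := fun i j => mul_nonneg hK.le (le_min (hb0 i j) (hb0 j i))
  have hXB : ∀ᵐ ω ∂μ, ∀ i j, |X ω i j| ≤ B i j := by
    have : ∀ᵐ ω ∂μ, ∀ i j, |X ω i j| ≤ K * b i j := by
      simpa only [ae_all_iff] using hb
    filter_upwards [this] with ω h i j
    simp only [B, mul_min_of_nonneg _ _ hK.le]
    refine le_min (h i j) ?_
    rw [← (hX.symm ω).apply i j]
    exact h j i
  set σ : ℝ := ⨆ i : Fin n, √(∑ j : Fin n, b i j ^ 2) with hσ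
  have hσi : ∀ i, √(∑ j : Fin n, b i j ^ 2) ≤ σ := fun i =>
    le_ciSup (f := fun i => √(∑ j : Fin n, b i j ^ 2)) (Set.finite_range _).bddAbove i
  have hσ0 : 0 ≤ σ := (Real.sqrt_nonneg _).trans (hσi ⟨0, by omega⟩)
  have hrow : ∀ i, ∑ j, B i j ^ 2 ≤ (K * σ) ^ 2 := by
    intro i
    calc ∑ j, B i j ^ 2 ≤ ∑ j, K ^ 2 * b i j ^ 2 := by
          refine Finset.sum_le_sum fun j _ => ?_
          rw [← mul_pow]
          have := hB0 i j
          gcongr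
          exact mul_le_mul_of_nonneg_left (min_le_left _ _) hK.le
      _ = K ^ 2 * ∑ j, b i j ^ 2 := by rw [Finset.mul_sum]
      _ ≤ K ^ 2 * σ ^ 2 := by
          gcongr
          exact (Real.sqrt_le_left hσ0).1 (hσi i)
      _ = _ := by ring
  obtain ⟨hi, hle⟩ := integrable_and_integral_le_sum_signMatrix hX hmean hB hXB
  refine ⟨hi, hle.trans ?_⟩
  rw [inv_mul_le_iff₀ (by positivity)]
  refine (sum_norm_signMatrix_le hn hB hB0 (by positivity) hrow).trans (le_of_eq ?_)
  ring
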